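/- Let $f:\mathbb R^n\to\mathbb R$, $A\in\mathbb R^{m\times n}$, $b\in\mathbb R^m$, $\ell,u\in\mathbb R^n$ with $\ell_i<u_i$ for all $i$, and consider the problem $$\min f(x)\quad\text{s.t. } Ax=b,\ x\in P,\qquad P=\{x\in\mathbb R^n:\ \ell_i\le x_i\le u_i,\ i=1,\dots,n\}.$$ All norms are Euclidean, $\sigma$ is the spectral norm of $A$, $[\cdot]_+$ is the Euclidean projection onto $P$, and $\iota_P$ is the indicator function of $P$ ($0$ on $P$, $+\infty$ elsewhere) with subdifferential $\partial\iota_P$. For $\epsilon>0$, a pair $(x,y)$ is an $\epsilon$-solution if $\|Ax-b\|\le\epsilon$ and there is a $v\in\nabla f(x)+A^Ty+\partial\iota_P(x)$ with $\|v\|\le\epsilon$. Assume: (a) the origin is in the relative interior of $\{Ax-b: x\in P\}$; (b) strict complementarity holds: for every $(x,y,\mu,\nu)$ with $\nabla f(x)+A^Ty-\mu+\nu=0$, $Ax=b$, $x\in P$, $\mu,\nu\ge 0$ and $\mu_i(\ell_i-x_i)=\nu_i(x_i-u_i)=0$ for all $i$, and for every $i$, exactly one of $\mu_i$, $\ell_i-x_i$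 is zero and exactly one of $\nu_i$, $x_i-u_i$ is zero; (c) $f$ is differentiable at every point of $P$ and, for some $L>0$, $\|\nabla f(x)-\nabla f(x')\|\le L\|x-x'\|$ for all $x,x'\in P$. Let $\gamma\in\mathbb R$ satisfy $\langle\nabla f(x)-\nabla f(x'),x-x'\rangle\ge\gamma\|x-x'\|^2$ for all $x,x'\in P$. For $\Gamma,p>0$ let $K(x,z;y)=f(x)+y^T(Ax-b)+\frac{\Gamma}{2}\|Ax-b\|^2+\frac p2\|x-z\|^2$. Given $x^0,z^0\in P$ and $y^0\in\mathbb R^m$, the proximal inexact augmented Lagrangian method with parameters $\Gamma,p,c,\alpha>0$ and $0<\beta\le 1$ generates, for $t=0,1,2,\dots$, $$y^{t+1}=y^t+\alpha(Ax^t-b),\quad x^{t+1}=[x^t-c\nabla_xK(x^t,z^t;y^{t+1})]_+,\quad z^{t+1}=z^t+\beta(x^{t+1}-z^t).$$ **Theorem.** Let $\Gamma>0$, $p>0$, $p>-\gamma$ and $0<c<1/(L+p+\Gamma\sigma^2)$. If the stepsize $\alpha>0$ is sufficiently small and then the stepsize $\beta\in(0,1]$ is sufficiently small (that is, there is $\alpha_0>0$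 such that for every $\alpha\in(0,\alpha_0)$ there is $\beta_0>0$ such that the following holds for every $\beta\in(0,1]$ with $\beta<\beta_0$), then for all initial points $x^0,z^0\in P$, $y^0\in\mathbb R^m$ there is a constant $B>0$ such that 1. for every integer $t>0$ there is an $s\in\{0,1,\dots,t-1\}$ such that $(x^{s+1},y^{s+1})$ is a $B/\sqrt t$-solution; 2. for every $\epsilon>0$ an $\epsilon$-solution is found within $B^2/\epsilon^2$ iterations (and in the first iteration if $B^2/\epsilon^2<1$): there is an integer $s\ge0$ with $s+1\le\max\{1,B^2/\epsilon^2\}$ such that $(x^{s+1},y^{s+1})$ is an $\epsilon$-solution. -/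

import Mathlib

open scoped Matrix Gradient

noncomputable section

namespace ProxALM

/-- The data of the problem: minimize `f x` subject to `A x = b` and `lo i ≤ x i ≤ up i`
for all `i`. -/
structure Problem (n m : ℕ) where
  /-- the objective function -/
  f : EuclideanSpace ℝ (Fin n) → ℝ
  /-- the constraint matrix -/
  A : Matrix (Fin m) (Fin n) ℝ
  /-- the right-hand side of the linear constraint -/
  b : EuclideanSpace ℝ (Fin m)
  /-- the lower bounds -/
  lo : EuclideanSpace ℝ (Fin n)
  /-- the upper bounds -/
  up : EuclideanSpace ℝ (Fin n)

namespace Problem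

variable {n m : ℕ} (Q : Problem n m)

/-- The box `P`. -/
def box : Set (EuclideanSpace ℝ (Fin n)) :=
  {x | ∀ i, Q.lo i ≤ x i ∧ x i ≤ Q.up i}

/-- The residual `A x - b`. -/
def residual (x : EuclideanSpace ℝ (Fin n)) : EuclideanSpace ℝ (Fin m) :=
  Q.A.toEuclideanLin x - Q.b

/-- The spectral norm of `A`: its operator norm between Euclidean spaces. -/
def sigma : ℝ := ‖Q.A.toEuclideanLin.toContinuousLinearMap‖

/-- The projection onto the box, coordinate by coordinate. -/
def proj (x : EuclideanSpace ℝ (Fin n)) : EuclideanSpace ℝ (Fin n) :=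
  WithLp.toLp 2 fun i => if x i < Q.lo i then Q.lo i else if Q.up i < x i then Q.up i else x i

/-- The KKT system of the problem; `μ` and `ν` are the multipliers of the lower and of the
upper bounds. -/
structure IsKKT (x : EuclideanSpace ℝ (Fin n)) (y : EuclideanSpace ℝ (Fin m))
    (μ ν : EuclideanSpace ℝ (Fin n)) : Prop where
  stationary : ∇ Q.f x + Q.Aᵀ.toEuclideanLin y - μ + ν = 0
  feasible : Q.A.toEuclideanLin x = Q.b
  bounds : ∀ i, Q.lo i ≤ x i ∧ x i ≤ Q.up i
  nonneg_lo : ∀ i, 0 ≤ μ i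
  nonneg_up : ∀ i, 0 ≤ ν i
  compl_lo : ∀ i, μ i * (Q.lo i - x i) = 0
  compl_up : ∀ i, ν i * (x i - Q.up i) = 0

/-- Strict complementarity: at every solution of the KKT system, for every `i`, exactly one of
`μ i` and `lo i - x i` is zero, and exactly one of `ν i` and `x i - up i` is zero. -/
def StrictComplementarity : Prop :=
  ∀ x y μ ν, Q.IsKKT x y μ ν →
    ∀ i, Xor (μ i = 0) (Q.lo i - x i = 0) ∧ Xor (ν i = 0) (x i - Q.up i = 0)

/-- The augmented Lagrangian `L(x; y) = f(x) + yᵀ(Ax - b) + (Γ/2)‖Ax - b‖²`. -/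
def augLagrangian (Γ : ℝ) (x : EuclideanSpace ℝ (Fin n)) (y : EuclideanSpace ℝ (Fin m)) : ℝ :=
  Q.f x + inner ℝ y (Q.residual x) + Γ / 2 * ‖Q.residual x‖ ^ 2

/-- The proximal augmented Lagrangian `K(x, z; y) = L(x; y) + (p/2)‖x - z‖²`. -/
def proxLagrangian (Γ p : ℝ) (x z : EuclideanSpace ℝ (Fin n))
    (y : EuclideanSpace ℝ (Fin m)) : ℝ :=
  Q.augLagrangian Γ x y + p / 2 * ‖x - z‖ ^ 2

end Problem

/-- The state `(x, y, z)` of the algorithm. -/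
structure State (n m : ℕ) where
  x : EuclideanSpace ℝ (Fin n)
  y : EuclideanSpace ℝ (Fin m)
  z : EuclideanSpace ℝ (Fin n)

namespace Problem

variable {n m : ℕ} (Q : Problem n m)

/-- One iteration of the proximal inexact augmented Lagrangian multiplier method:
`y⁺ = y + α(Ax - b)`, `x⁺ = [x - c ∇ₓK(x, z; y⁺)]₊`, `z⁺ = z + β(x⁺ - z)`. -/
def step (Γ p c α β : ℝ) (w : State n m) : State n m :=
  let y' := w.y + α • Q.residual w.x
  let x' := Q.proj (w.x - c • ∇ (fun x => Q.proxLagrangian Γ p x w.z y') w.x)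
  let z' := w.z + β • (x' - w.z)
  ⟨x', y', z'⟩

/-- The state `(x^t, y^t, z^t)` after `t` iterations from the initial state `w₀`. -/
def iterate (Γ p c α β : ℝ) (w₀ : State n m) : ℕ → State n m
  | 0 => w₀
  | t + 1 => Q.step Γ p c α β (iterate Γ p c α β w₀ t)

end Problem

open Classical in
/-- The indicator function of a set in the sense of convex analysis: `0` on `S` and `∞` off
`S`. -/
def convexIndicator {E : Type*} (S : Set E) (x : E) : EReal := if x ∈ S then 0 else ⊤

/-- The subdifferential of an extended-real-valued function: all `g` with
`h w ≥ h x + ⟪g, w - x⟫` for every `w`. -/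
def subdifferential {E : Type*} [NormedAddCommGroup E] [InnerProductSpace ℝ E]
    (h : E → EReal) (x : E) : Set E :=
  {g | ∀ w, h x + ((inner ℝ g (w - x) : ℝ) : EReal) ≤ h w}

/-- `(x, y)` is an `ε`-solution: `‖Ax - b‖ ≤ ε`, and some `v ∈ ∇f(x) + Aᵀy + ∂ι_P(x)` has
`‖v‖ ≤ ε`. -/
def Problem.IsEpsSolution {n m : ℕ} (Q : Problem n m) (ε : ℝ)
    (x : EuclideanSpace ℝ (Fin n)) (y : EuclideanSpace ℝ (Fin m)) : Prop :=
  ‖Q.A.toEuclideanLin x - Q.b‖ ≤ ε ∧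
    ∃ g ∈ subdifferential (convexIndicator Q.box) x,
      ‖∇ Q.f x + Q.Aᵀ.toEuclideanLin y + g‖ ≤ ε

end ProxALM

end

/-!
Convergence rate of the proximal inexact augmented Lagrangian method on a box.

Write `K(x, z; y)` for the proximal augmented Lagrangian, `d(y, z)` for its minimum over the box,
and `M(z)` for its minimum over the points of the box with `A x = b`, where it does not depend
on `y`. Since `p + γ > 0`, the gradient of `K(·, z; y)` is strongly monotone on the box, uniformly
in `y` and `z`. The potential `K - 2 d + 2 M = (K - d) + (M - d) + M` is bounded below by the
minimum of `f` over the box, whatever the multipliers do. One iteration decreases it by a positive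
combination of `‖x - x⁺‖²`, `‖A u - b‖²` and `‖z⁺ - z‖²`, where `u` minimizes `K(·, z; y⁺)` over the
box (`potential_decrease`). These three quantities bound the violation of the optimality conditions
at `(x⁺, y⁺)` (`isEpsSolution_proj`), so averaging the decrements over the first `t` iterations
gives an iterate with violation `O(1 / √t)`.

The decrease rests on two error bounds. The primal one (`norm_sub_minimizer_le`) estimates `‖x - u‖`
by the length of a projected gradient step. The dual one (`exists_dual_error_bound`) estimates the
distance from `u` to the minimizer `s` over the feasible set by `‖A u - b‖`, with a constant that
does not depend on `y` or `z`. It holds globally, because the constraint set is a box: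
`exists_conformal` replaces `s - u` by a vector `d` with `A d = A (s - u)`, with entries between `0`
and those of `s - u`, and with `‖d‖ ≤ C ‖A u - b‖`. Then `u + d` is feasible, and `s - d` is a point
of the box with the residual of `u`. Testing the optimality conditions of `s` and `u` with these points
and adding gives `⟪∇K(s) - ∇K(u), s - u⟫ ≤ ⟪∇K(s) - ∇K(u), d⟫`, and strong monotonicity on the
left and Lipschitz continuity on the right yield the bound.
-/

noncomputable section

namespace ProxALM

open Set Filter Topology

/-! ### Conformal solutions of linear systems -/

/-- A linear map that kills no nonzero vector of a closed cone is bounded below on it, since it has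
a positive minimum on the unit vectors of the cone. -/
lemma exists_norm_le_of_isClosed_cone {E F : Type*} [NormedAddCommGroup E] [NormedSpace ℝ E]
    [FiniteDimensional ℝ E] [NormedAddCommGroup F] [NormedSpace ℝ F] (T : E →ₗ[ℝ] F)
    {K : Set E} (hK : IsClosed K) (hcone : ∀ a : ℝ, 0 ≤ a → ∀ e ∈ K, a • e ∈ K)
    (hker : ∀ e ∈ K, T e = 0 → e = 0) :
    ∃ C : ℝ, 0 ≤ C ∧ ∀ e ∈ K, ‖e‖ ≤ C * ‖T e‖ := by
  have hnormalize : ∀ e ∈ K, e ≠ 0 → ‖e‖⁻¹ • e ∈ K ∩ Metric.sphere 0 1 := fun e he h0 =>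
    ⟨hcone _ (by positivity) e he, by
      simp [norm_smul, inv_mul_cancel₀ (norm_ne_zero_iff.2 h0)]⟩
  have hcomp : IsCompact (K ∩ Metric.sphere (0 : E) 1) := (isCompact_sphere 0 1).inter_left hK
  rcases (K ∩ Metric.sphere (0 : E) 1).eq_empty_or_nonempty with hemp | hne
  · refine ⟨0, le_rfl, fun e he => ?_⟩
    by_cases h0 : e = 0
    · simp [h0]
    · exact absurd (hnormalize e he h0) (by simp [hemp])
  · have hcont : Continuous fun e => ‖T e‖ := T.continuous_of_finiteDimensional.norm
    obtain ⟨e₀, ⟨he₀, hs⟩, hmin⟩ := hcomp.exists_isMinOn hne hcont.continuousOn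
    have hpos : 0 < ‖T e₀‖ := norm_pos_iff.2 fun h => by
      simp [hker e₀ he₀ h] at hs
    refine ⟨‖T e₀‖⁻¹, by positivity, fun e he => ?_⟩
    by_cases h0 : e = 0
    · simp [h0]
    · have h1 : ‖T e₀‖ ≤ ‖T (‖e‖⁻¹ • e)‖ := hmin (hnormalize e he h0)
      have hep : 0 < ‖e‖ := norm_pos_iff.2 h0
      rw [map_smul, norm_smul, norm_inv, norm_norm, inv_mul_eq_div, le_div_iff₀ hep] at h1
      rw [inv_mul_eq_div, le_div_iff₀ hpos]
      linarith

/-- The closed cone of the vectors whose entries are zero or have the sign prescribed by `s`. -/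
def signCone {n : ℕ} (s : Fin n → SignType) : Set (EuclideanSpace ℝ (Fin n)) :=
  {e | ∀ i, 0 ≤ (s i : ℝ) * e i ∧ (s i = 0 → e i = 0)}

lemma isClosed_signCone {n : ℕ} (s : Fin n → SignType) : IsClosed (signCone s) := by
  have : signCone s = ⋂ i, ({e : EuclideanSpace ℝ (Fin n) | 0 ≤ (s i : ℝ) * e i} ∩
      {e | s i = 0 → e i = 0}) := by
    ext e; simp [signCone]
  rw [this]
  refine isClosed_iInter fun i => (isClosed_le (by fun_prop) (by fun_prop)).inter ?_
  by_cases h : s i = 0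
  · simpa [h] using isClosed_eq (by fun_prop) (by fun_prop)
  · simp [h]

/-- Since there are finitely many sign patterns, one constant serves for all the sign cones that
meet the kernel only at the origin. -/
lemma exists_norm_le_of_signCone {n : ℕ} {F : Type*} [NormedAddCommGroup F] [NormedSpace ℝ F]
    (T : EuclideanSpace ℝ (Fin n) →ₗ[ℝ] F) :
    ∃ C : ℝ, 0 ≤ C ∧ ∀ s : Fin n → SignType, (∀ e ∈ signCone s, T e = 0 → e = 0) →
      ∀ e ∈ signCone s, ‖e‖ ≤ C * ‖T e‖ := by
  have key : ∀ s : Fin n → SignType, ∃ C : ℝ, 0 ≤ C ∧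
      ((∀ e ∈ signCone s, T e = 0 → e = 0) → ∀ e ∈ signCone s, ‖e‖ ≤ C * ‖T e‖) := by
    intro s
    by_cases h : ∀ e ∈ signCone s, T e = 0 → e = 0
    · obtain ⟨C, hC, hb⟩ := exists_norm_le_of_isClosed_cone T (isClosed_signCone s)
        (fun a ha e he i => ⟨by
          have := mul_nonneg ha (he i).1
          simp only [PiLp.smul_apply, smul_eq_mul]
          linarith, fun hi => by simp [(he i).2 hi]⟩) h
      exact ⟨C, hC, fun _ => hb⟩
    · exact ⟨0, le_rfl, fun h' => absurd h' h⟩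
  choose C hC hb using key
  refine ⟨∑ s, C s, Finset.sum_nonneg fun s _ => hC s, fun s hs e he => ?_⟩
  exact (hb s hs e he).trans (mul_le_mul_of_nonneg_right
    (Finset.single_le_sum (fun s _ => hC s) (Finset.mem_univ s)) (norm_nonneg _))

/-- Every `d₀` can be shrunk, entry by entry and without changing `T d₀`, to a vector `d` whose
norm is controlled by `‖T d₀‖`. The vector `d` of least norm does it: a kernel vector with the
signs of `d` could be subtracted from `d`, so the sign cone of `d` meets the kernel only
at the origin. -/
lemma exists_conformal {n : ℕ} {F : Type*} [NormedAddCommGroup F] [NormedSpace ℝ F]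
    (T : EuclideanSpace ℝ (Fin n) →ₗ[ℝ] F) :
    ∃ C : ℝ, 0 ≤ C ∧ ∀ d₀ : EuclideanSpace ℝ (Fin n), ∃ d : EuclideanSpace ℝ (Fin n),
      T d = T d₀ ∧ (∀ i, d i ∈ uIcc 0 (d₀ i)) ∧ ‖d‖ ≤ C * ‖T d₀‖ := by
  obtain ⟨C, hC, hb⟩ := exists_norm_le_of_signCone T
  refine ⟨C, hC, fun d₀ => ?_⟩
  set S : Set (EuclideanSpace ℝ (Fin n)) := {d | T d = T d₀ ∧ ∀ i, d i ∈ uIcc 0 (d₀ i)} with hS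
  have hclosed : IsClosed S := by
    have : S = {d | T d = T d₀} ∩ ⋂ i, (fun d : EuclideanSpace ℝ (Fin n) => d i) ⁻¹'
        uIcc 0 (d₀ i) := by
      ext d; simp [hS]
    rw [this]
    exact (isClosed_eq T.continuous_of_finiteDimensional continuous_const).inter
      (isClosed_iInter fun i => isClosed_Icc.preimage (by fun_prop))
  have hbdd : S ⊆ Metric.closedBall 0 ‖d₀‖ := by
    intro d hd
    rw [mem_closedBall_zero_iff, EuclideanSpace.norm_eq, EuclideanSpace.norm_eq]
    refine Real.sqrt_le_sqrt (Finset.sum_le_sum fun i _ => ?_)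
    have := abs_sub_left_of_mem_uIcc (hd.2 i)
    simp only [sub_zero] at this
    simpa [Real.norm_eq_abs] using sq_le_sq.2 this
  have hcomp : IsCompact S := (isCompact_closedBall 0 ‖d₀‖).of_isClosed_subset hclosed hbdd
  obtain ⟨d, hd, hmin⟩ := hcomp.exists_isMinOn ⟨d₀, rfl, fun i => right_mem_uIcc⟩
    continuous_norm.continuousOn
  refine ⟨d, hd.1, hd.2, ?_⟩
  rw [← hd.1]
  refine hb (fun i => SignType.sign (d i)) ?_ d fun i => ⟨?_, fun h => by simpa using h⟩
  · intro e he hTe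
    have hτ : ∀ᶠ τ : ℝ in 𝓝[>] 0, ∀ i, τ * |e i| ≤ |d i| := by
      refine eventually_all.2 fun i => ?_
      by_cases hdi : d i = 0
      · have : e i = 0 := (he i).2 (by simp [hdi])
        simp [this]
      · have h1 : Tendsto (fun τ : ℝ => τ * |e i|) (𝓝[>] 0) (𝓝 (0 * |e i|)) :=
          (Continuous.tendsto (by fun_prop) 0).mono_left nhdsWithin_le_nhds
        rw [zero_mul] at h1
        exact (h1.eventually (gt_mem_nhds (abs_pos.2 hdi))).mono fun τ h => h.le
    obtain ⟨τ, hτ, hτ0⟩ := (hτ.and self_mem_nhdsWithin).exists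
    have hτ0 : 0 < τ := hτ0
    -- Subtracting `τ • e` moves every entry of `d` towards zero but not past it.
    have hcase : ∀ i, d i - τ * e i ∈ uIcc 0 (d i) ∧ τ * e i * e i ≤ d i * e i := by
      intro i
      have h1 := hτ i
      have h2 := (he i).1
      have h3 := (he i).2
      rcases lt_trichotomy (d i) 0 with h | h | h
      · simp only [sign_neg h, SignType.coe_neg_one, neg_mul, one_mul, neg_nonneg] at h2
        rw [abs_of_neg h, abs_of_nonpos h2] at h1
        exact ⟨mem_uIcc.2 (Or.inr ⟨by nlinarith, by linarith⟩), by nlinarith⟩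
      · simp [h3 (by simp [h])]
      · simp only [sign_pos h, SignType.coe_one, one_mul] at h2
        rw [abs_of_pos h, abs_of_nonneg h2] at h1
        exact ⟨mem_uIcc.2 (Or.inl ⟨by linarith, by nlinarith⟩), by nlinarith⟩
    have hmem : d - τ • e ∈ S := by
      refine ⟨by simp [hTe, hd.1], fun i => ?_⟩
      exact uIcc_subset_uIcc_left (hd.2 i) (by simpa using (hcase i).1)
    have hle : ‖d‖ ≤ ‖d - τ • e‖ := hmin hmem
    have hinner : τ * ‖e‖ ^ 2 ≤ inner ℝ d e := by
      rw [EuclideanSpace.norm_sq_eq, PiLp.inner_apply, Finset.mul_sum]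
      refine Finset.sum_le_sum fun i _ => ?_
      have := (hcase i).2
      simp only [Real.norm_eq_abs, sq_abs, RCLike.inner_apply, conj_trivial]
      nlinarith
    have hsq : ‖d‖ ^ 2 ≤ ‖d - τ • e‖ ^ 2 := by gcongr
    rw [norm_sub_sq_real, norm_smul, inner_smul_right, Real.norm_of_nonneg hτ0.le, mul_pow] at hsq
    have h4 : τ ^ 2 * ‖e‖ ^ 2 ≤ 0 := by nlinarith
    have h5 : ‖e‖ ^ 2 ≤ 0 := by
      by_contra! h
      nlinarith [mul_pos (pow_pos hτ0 2) h]
    simpa using le_antisymm h5 (sq_nonneg _)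
  · rw [sign_mul_self]
    exact abs_nonneg _

/-! ### Smooth functions on convex sets -/

section Smooth

variable {E : Type*} [NormedAddCommGroup E] [InnerProductSpace ℝ E] [CompleteSpace E]

/-- The descent lemma: the derivative of
`τ ↦ h (x + τ d) - τ ⟪g x, d⟫ - τ² L ‖d‖² / 2` along the segment is nonpositive. -/
lemma le_add_inner_add_of_lipschitz {S : Set E} (hS : Convex ℝ S) {h : E → ℝ} {g : E → E} {L : ℝ}
    (hg : ∀ x ∈ S, HasGradientAt h (g x) x)
    (hL : ∀ x ∈ S, ∀ x' ∈ S, ‖g x - g x'‖ ≤ L * ‖x - x'‖) {x x' : E} (hx : x ∈ S) (hx' : x' ∈ S) :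
    h x' ≤ h x + inner ℝ (g x) (x' - x) + L / 2 * ‖x' - x‖ ^ 2 := by
  set d := x' - x with hd
  have hseg : ∀ τ ∈ Icc (0 : ℝ) 1, x + τ • d ∈ S := fun τ hτ =>
    hS.add_smul_sub_mem hx hx' hτ
  let ψ : ℝ → ℝ := fun τ => h (x + τ • d) - τ * inner ℝ (g x) d - τ ^ 2 * (L / 2 * ‖d‖ ^ 2)
  have hder : ∀ τ ∈ Icc (0 : ℝ) 1, HasDerivAt ψ
      (inner ℝ (g (x + τ • d)) d - inner ℝ (g x) d - 2 * τ * (L / 2 * ‖d‖ ^ 2)) τ := by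
    intro τ hτ
    have h1 : HasDerivAt (fun τ : ℝ => x + τ • d) d τ := by
      simpa using ((hasDerivAt_id τ).smul_const d).const_add x
    have h2 := (hg _ (hseg τ hτ)).hasFDerivAt.comp_hasDerivAt τ h1
    have h3 := (hasDerivAt_id τ).mul_const (inner ℝ (g x) d)
    have h4 := (hasDerivAt_pow 2 τ).mul_const (L / 2 * ‖d‖ ^ 2)
    have h5 : HasDerivAt ψ _ τ := (h2.sub h3).sub h4
    convert h5 using 1
    simp
  have hanti : AntitoneOn ψ (Icc 0 1) := by
    refine antitoneOn_of_hasDerivWithinAt_nonpos (convex_Icc 0 1)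
      (fun τ hτ => (hder τ hτ).continuousAt.continuousWithinAt)
      (fun τ hτ => (hder τ (interior_subset hτ)).hasDerivWithinAt) fun τ hτ => ?_
    have hτ := interior_subset hτ
    have h1 := hL _ (hseg τ hτ) x hx
    rw [add_sub_cancel_left, norm_smul, Real.norm_of_nonneg hτ.1] at h1
    have h2 := real_inner_le_norm (g (x + τ • d) - g x) d
    rw [inner_sub_left] at h2
    have h3 := mul_le_mul_of_nonneg_right h1 (norm_nonneg d)
    nlinarith
  have := hanti (left_mem_Icc.2 zero_le_one) (right_mem_Icc.2 zero_le_one) zero_le_one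
  simp only [ψ, one_smul, zero_smul, add_zero, hd, add_sub_cancel] at this
  simp only [hd]
  linarith

lemma inner_nonneg_of_isMinOn {S : Set E} (hS : Convex ℝ S) {h : E → ℝ} {g x : E}
    (hg : HasGradientAt h g x) (hmin : IsMinOn h S x) (hx : x ∈ S) {w : E} (hw : w ∈ S) :
    0 ≤ inner ℝ g (w - x) := by
  have := hmin.localize.hasFDerivWithinAt_nonneg hg.hasFDerivAt.hasFDerivWithinAt
    (sub_mem_posTangentConeAt_of_segment_subset (hS.segment_subset hx hw))
  simpa using this

end Smooth

namespace Problem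

variable {n m : ℕ} (Q : Problem n m)

/-! ### The box and the linear constraint -/

lemma inner_transpose (y : EuclideanSpace ℝ (Fin m)) (x : EuclideanSpace ℝ (Fin n)) :
    inner ℝ (Q.Aᵀ.toEuclideanLin y) x = inner ℝ y (Q.A.toEuclideanLin x) := by
  rw [← Matrix.conjTranspose_eq_transpose_of_trivial,
    Matrix.toEuclideanLin_conjTranspose_eq_adjoint, LinearMap.adjoint_inner_left]

lemma sigma_nonneg : 0 ≤ Q.sigma := norm_nonneg _

lemma norm_mulVec_le (x : EuclideanSpace ℝ (Fin n)) :
    ‖Q.A.toEuclideanLin x‖ ≤ Q.sigma * ‖x‖ :=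
  Q.A.toEuclideanLin.toContinuousLinearMap.le_opNorm x

lemma norm_transpose_mulVec_le (y : EuclideanSpace ℝ (Fin m)) :
    ‖Q.Aᵀ.toEuclideanLin y‖ ≤ Q.sigma * ‖y‖ := by
  set v := Q.Aᵀ.toEuclideanLin y with hv
  have h1 : ‖v‖ ^ 2 = inner ℝ y (Q.A.toEuclideanLin v) := by
    rw [← inner_transpose, real_inner_self_eq_norm_sq]
  have h2 := real_inner_le_norm y (Q.A.toEuclideanLin v)
  have h3 := mul_le_mul_of_nonneg_left (Q.norm_mulVec_le v) (norm_nonneg y)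
  by_contra! h
  nlinarith [norm_nonneg v, mul_nonneg Q.sigma_nonneg (norm_nonneg y)]

lemma residual_sub_residual (x x' : EuclideanSpace ℝ (Fin n)) :
    Q.residual x - Q.residual x' = Q.A.toEuclideanLin (x - x') := by
  simp [residual]

lemma norm_residual_sub_le (x x' : EuclideanSpace ℝ (Fin n)) :
    ‖Q.residual x - Q.residual x'‖ ≤ Q.sigma * ‖x - x'‖ := by
  rw [residual_sub_residual]
  exact Q.norm_mulVec_le _

lemma continuous_residual : Continuous Q.residual :=
  Q.A.toEuclideanLin.continuous_of_finiteDimensional.sub continuous_const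

lemma convex_box : Convex ℝ Q.box := by
  intro x hx x' hx' a a' ha ha' haa i
  simpa using convex_Icc (Q.lo i) (Q.up i) (hx i) (hx' i) ha ha' haa

lemma isCompact_box : IsCompact Q.box := by
  have : Q.box = (EuclideanSpace.equiv (Fin n) ℝ).symm ''
      Set.pi univ fun i => Icc (Q.lo i) (Q.up i) := by
    ext x
    constructor
    · exact fun hx => ⟨fun i => x i, fun i _ => hx i, rfl⟩
    · rintro ⟨v, hv, rfl⟩ i
      exact hv i trivial
  rw [this]
  exact (isCompact_univ_pi fun i => isCompact_Icc).image
    (EuclideanSpace.equiv (Fin n) ℝ).symm.continuous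

/-- The points of the box that satisfy the linear constraint. -/
def feasibleSet : Set (EuclideanSpace ℝ (Fin n)) := {x | x ∈ Q.box ∧ Q.residual x = 0}

lemma isCompact_feasibleSet : IsCompact Q.feasibleSet :=
  Q.isCompact_box.inter_right (isClosed_eq Q.continuous_residual continuous_const)

lemma convex_feasibleSet : Convex ℝ Q.feasibleSet := by
  have : Convex ℝ {x | Q.residual x = 0} := by
    intro x hx x' hx' a a' _ _ haa
    have hx : Q.A.toEuclideanLin x = Q.b := sub_eq_zero.1 hx
    have hx' : Q.A.toEuclideanLin x' = Q.b := sub_eq_zero.1 hx'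
    refine sub_eq_zero.2 ?_
    rw [map_add, map_smul, map_smul, hx, hx', ← add_smul, haa, one_smul]
  exact Q.convex_box.inter this

variable {Q}

lemma proj_mem (hbox : ∀ i, Q.lo i < Q.up i) (x : EuclideanSpace ℝ (Fin n)) :
    Q.proj x ∈ Q.box := by
  intro i
  have := hbox i
  simp only [proj]
  split_ifs <;> constructor <;> linarith

/-- The variational inequality that characterises the projection onto the box. -/
lemma inner_sub_proj_nonpos (x : EuclideanSpace ℝ (Fin n)) {w : EuclideanSpace ℝ (Fin n)}
    (hw : w ∈ Q.box) : inner ℝ (x - Q.proj x) (w - Q.proj x) ≤ 0 := by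
  rw [PiLp.inner_apply]
  refine Finset.sum_nonpos fun i _ => ?_
  have := hw i
  simp only [proj, PiLp.sub_apply, RCLike.inner_apply, conj_trivial]
  split_ifs <;> nlinarith

lemma mem_subdifferential_convexIndicator {E : Type*} [NormedAddCommGroup E]
    [InnerProductSpace ℝ E] {S : Set E} {x g : E} (hx : x ∈ S)
    (hg : ∀ w ∈ S, inner ℝ g (w - x) ≤ 0) : g ∈ subdifferential (convexIndicator S) x := by
  intro w
  by_cases hw : w ∈ S
  · simpa [convexIndicator, hx, hw] using hg w hw
  · simp [convexIndicator, hw]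

lemma IsEpsSolution.mono {ε ε' : ℝ} {x : EuclideanSpace ℝ (Fin n)}
    {y : EuclideanSpace ℝ (Fin m)} (h : Q.IsEpsSolution ε x y) (hε : ε ≤ ε') :
    Q.IsEpsSolution ε' x y :=
  ⟨h.1.trans hε, h.2.imp fun _ hg => ⟨hg.1, hg.2.trans hε⟩⟩

/-! ### The proximal augmented Lagrangian -/

/-- The analytic assumptions on the objective: it is differentiable at the points of the box, and
there its gradient is `L`-Lipschitz and `γ`-monotone (`γ` may be negative). -/
structure SmoothOnBox (Q : Problem n m) (L γ : ℝ) : Prop where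
  differentiableAt : ∀ x ∈ Q.box, DifferentiableAt ℝ Q.f x
  lipschitz : ∀ x ∈ Q.box, ∀ x' ∈ Q.box, ‖∇ Q.f x - ∇ Q.f x'‖ ≤ L * ‖x - x'‖
  monotone : ∀ x ∈ Q.box, ∀ x' ∈ Q.box,
    γ * ‖x - x'‖ ^ 2 ≤ inner ℝ (∇ Q.f x - ∇ Q.f x') (x - x')

variable (Q) in
/-- The gradient in `x` of the proximal augmented Lagrangian `K(x, z; y)`. -/
def proxGradient (Γ p : ℝ) (x z : EuclideanSpace ℝ (Fin n)) (y : EuclideanSpace ℝ (Fin m)) :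
    EuclideanSpace ℝ (Fin n) :=
  ∇ Q.f x + Q.Aᵀ.toEuclideanLin y + Γ • Q.Aᵀ.toEuclideanLin (Q.residual x) + p • (x - z)

lemma proxLagrangian_of_residual_eq_zero (Γ p : ℝ) {x : EuclideanSpace ℝ (Fin n)}
    (z : EuclideanSpace ℝ (Fin n)) (y : EuclideanSpace ℝ (Fin m)) (hx : Q.residual x = 0) :
    Q.proxLagrangian Γ p x z y = Q.f x + p / 2 * ‖x - z‖ ^ 2 := by
  simp [proxLagrangian, augLagrangian, hx]

lemma hasGradientAt_proxLagrangian (Γ p : ℝ) {x : EuclideanSpace ℝ (Fin n)}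
    (z : EuclideanSpace ℝ (Fin n)) (y : EuclideanSpace ℝ (Fin m)) (hx : DifferentiableAt ℝ Q.f x) :
    HasGradientAt (fun x => Q.proxLagrangian Γ p x z y) (Q.proxGradient Γ p x z y) x := by
  rw [hasGradientAt_iff_hasFDerivAt]
  have hf := hx.hasGradientAt.hasFDerivAt
  have hr : HasFDerivAt Q.residual Q.A.toEuclideanLin.toContinuousLinearMap x :=
    Q.A.toEuclideanLin.toContinuousLinearMap.hasFDerivAt.sub_const Q.b
  have hi := (innerSL ℝ y).hasFDerivAt.comp x hr
  have hn := hr.norm_sq.const_mul (Γ / 2)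
  have hz := (((hasFDerivAt_id x).sub_const z).norm_sq).const_mul (p / 2)
  refine (((hf.add hi).add hn).add hz).congr_fderiv ?_
  ext d
  simp [proxGradient, inner_transpose]
  ring

namespace SmoothOnBox

variable {L γ : ℝ}

lemma hasGradientAt (h : Q.SmoothOnBox L γ) (Γ p : ℝ) {x : EuclideanSpace ℝ (Fin n)}
    (z : EuclideanSpace ℝ (Fin n)) (y : EuclideanSpace ℝ (Fin m)) (hx : x ∈ Q.box) :
    HasGradientAt (fun x => Q.proxLagrangian Γ p x z y) (Q.proxGradient Γ p x z y) x :=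
  hasGradientAt_proxLagrangian Γ p z y (h.differentiableAt x hx)

lemma continuousOn_proxLagrangian (h : Q.SmoothOnBox L γ) (Γ p : ℝ)
    (z : EuclideanSpace ℝ (Fin n)) (y : EuclideanSpace ℝ (Fin m)) :
    ContinuousOn (fun x => Q.proxLagrangian Γ p x z y) Q.box := fun _ hx =>
  (h.hasGradientAt Γ p z y hx).hasFDerivAt.continuousAt.continuousWithinAt

lemma exists_isMinOn_box (h : Q.SmoothOnBox L γ) (hne : Q.box.Nonempty) (Γ p : ℝ)
    (z : EuclideanSpace ℝ (Fin n)) (y : EuclideanSpace ℝ (Fin m)) :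
    ∃ u ∈ Q.box, IsMinOn (fun x => Q.proxLagrangian Γ p x z y) Q.box u :=
  Q.isCompact_box.exists_isMinOn hne (h.continuousOn_proxLagrangian Γ p z y)

lemma exists_isMinOn_feasibleSet (h : Q.SmoothOnBox L γ) (hne : Q.feasibleSet.Nonempty) (Γ p : ℝ)
    (z : EuclideanSpace ℝ (Fin n)) (y : EuclideanSpace ℝ (Fin m)) :
    ∃ s ∈ Q.feasibleSet, IsMinOn (fun x => Q.proxLagrangian Γ p x z y) Q.feasibleSet s :=
  Q.isCompact_feasibleSet.exists_isMinOn hne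
    ((h.continuousOn_proxLagrangian Γ p z y).mono fun _ hx => hx.1)

lemma norm_proxGradient_sub_le (h : Q.SmoothOnBox L γ) {Γ p : ℝ} (hΓ : 0 ≤ Γ) (hp : 0 ≤ p)
    {x x' : EuclideanSpace ℝ (Fin n)} (z : EuclideanSpace ℝ (Fin n))
    (y : EuclideanSpace ℝ (Fin m)) (hx : x ∈ Q.box) (hx' : x' ∈ Q.box) :
    ‖Q.proxGradient Γ p x z y - Q.proxGradient Γ p x' z y‖ ≤
      (L + p + Γ * Q.sigma ^ 2) * ‖x - x'‖ := by
  have heq : Q.proxGradient Γ p x z y - Q.proxGradient Γ p x' z y = (∇ Q.f x - ∇ Q.f x') +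
      Γ • Q.Aᵀ.toEuclideanLin (Q.residual x - Q.residual x') + p • (x - x') := by
    simp only [proxGradient, map_sub]
    module
  have h1 := h.lipschitz x hx x' hx'
  have h2 := Q.norm_transpose_mulVec_le (Q.residual x - Q.residual x')
  have h3 := mul_le_mul_of_nonneg_left (Q.norm_residual_sub_le x x') Q.sigma_nonneg
  have h4 := mul_le_mul_of_nonneg_left (h2.trans h3) hΓ
  rw [heq]
  refine (norm_add₃_le).trans ?_
  rw [norm_smul, norm_smul, Real.norm_of_nonneg hΓ, Real.norm_of_nonneg hp]
  linarith

lemma inner_proxGradient_sub_ge (h : Q.SmoothOnBox L γ) {Γ : ℝ} (p : ℝ) (hΓ : 0 ≤ Γ)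
    {x x' : EuclideanSpace ℝ (Fin n)} (z : EuclideanSpace ℝ (Fin n))
    (y : EuclideanSpace ℝ (Fin m)) (hx : x ∈ Q.box) (hx' : x' ∈ Q.box) :
    (p + γ) * ‖x - x'‖ ^ 2 ≤
      inner ℝ (Q.proxGradient Γ p x z y - Q.proxGradient Γ p x' z y) (x - x') := by
  have heq : Q.proxGradient Γ p x z y - Q.proxGradient Γ p x' z y = (∇ Q.f x - ∇ Q.f x') +
      Γ • Q.Aᵀ.toEuclideanLin (Q.residual x - Q.residual x') + p • (x - x') := by
    simp only [proxGradient, map_sub]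
    module
  have h1 := h.monotone x hx x' hx'
  rw [heq, inner_add_left, inner_add_left, real_inner_smul_left, real_inner_smul_left,
    inner_transpose, ← residual_sub_residual, real_inner_self_eq_norm_sq,
    real_inner_self_eq_norm_sq]
  nlinarith [mul_nonneg hΓ (sq_nonneg ‖Q.residual x - Q.residual x'‖)]

/-! ### Error bounds -/

/-- The distance to the minimizer `u` of `K(·, z; y)` over the box is controlled by the length of
one projected gradient step. -/
lemma norm_sub_minimizer_le (h : Q.SmoothOnBox L γ) (hbox : ∀ i, Q.lo i < Q.up i)
    {Γ p c : ℝ} (hΓ : 0 ≤ Γ) (hp : 0 ≤ p) (hκ : 0 < p + γ) (hc : 0 < c)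
    {x z u : EuclideanSpace ℝ (Fin n)} {y : EuclideanSpace ℝ (Fin m)} (hx : x ∈ Q.box)
    (hu : u ∈ Q.box) (hmin : IsMinOn (fun x => Q.proxLagrangian Γ p x z y) Q.box u) :
    ‖x - u‖ ≤ (1 + c * (L + p + Γ * Q.sigma ^ 2)) / (c * (p + γ)) *
      ‖x - Q.proj (x - c • Q.proxGradient Γ p x z y)‖ := by
  set G := Q.proxGradient Γ p x z y with hG
  set x' := Q.proj (x - c • G) with hx'
  have h1 := inner_nonneg_of_isMinOn Q.convex_box (h.hasGradientAt Γ p z y hu) hmin hu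
    (proj_mem hbox (x - c • G))
  have h2 := inner_sub_proj_nonpos (x - c • G) hu
  have h3 := h.inner_proxGradient_sub_ge p hΓ z y hx hu
  have h4 := h.norm_proxGradient_sub_le hΓ hp z y hx hu
  rw [← hG] at h3 h4
  rw [← hx'] at h1 h2
  set H := Q.proxGradient Γ p u z y
  have key : c * inner ℝ (G - H) (x - u) ≤
      inner ℝ (x - x') (x - u) + c * inner ℝ (G - H) (x - x') := by
    have e1 : x - c • G - x' = (x - x') - c • G := by abel
    have e2 : u - x' = (x - x') - (x - u) := by abel
    have e3 : x' - u = (x - u) - (x - x') := by abel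
    rw [e1, e2] at h2
    rw [e3] at h1
    simp only [inner_sub_left (x - x'), inner_sub_right _ (x - x'), inner_sub_right _ (x - u),
      real_inner_smul_left, inner_sub_left G] at h1 h2 ⊢
    nlinarith [real_inner_self_nonneg (x := x - x')]
  have h5 := real_inner_le_norm (x - x') (x - u)
  have h6 := real_inner_le_norm (G - H) (x - x')
  have h7 := mul_le_mul_of_nonneg_right h4 (norm_nonneg (x - x'))
  have h8 := mul_le_mul_of_nonneg_left h3 hc.le
  have h9 := mul_le_mul_of_nonneg_left (h6.trans h7) hc.le
  rw [div_mul_eq_mul_div, le_div_iff₀ (mul_pos hc hκ)]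
  rcases (norm_nonneg (x - u)).eq_or_lt with h0 | h0
  · rw [← h0] at h4 ⊢
    have hLK : 0 ≤ (L + p + Γ * Q.sigma ^ 2) * ‖x - x'‖ :=
      (norm_nonneg _).trans (h.norm_proxGradient_sub_le hΓ hp z y hx (proj_mem hbox (x - c • G)))
    nlinarith [norm_nonneg (x - x'), mul_nonneg hc.le hLK]
  · refine le_of_mul_le_mul_right ?_ h0
    nlinarith

/-- The minimizer of `K(·, z; y)` over the box is a Lipschitz function of `z`. -/
lemma norm_minimizer_sub_le (h : Q.SmoothOnBox L γ) {Γ p : ℝ} (hΓ : 0 ≤ Γ) (hp : 0 ≤ p)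
    (hκ : 0 < p + γ) {z z' u v : EuclideanSpace ℝ (Fin n)} {y : EuclideanSpace ℝ (Fin m)}
    (hu : u ∈ Q.box) (hv : v ∈ Q.box)
    (humin : IsMinOn (fun x => Q.proxLagrangian Γ p x z y) Q.box u)
    (hvmin : IsMinOn (fun x => Q.proxLagrangian Γ p x z' y) Q.box v) :
    ‖u - v‖ ≤ p / (p + γ) * ‖z' - z‖ := by
  have h1 := inner_nonneg_of_isMinOn Q.convex_box (h.hasGradientAt Γ p z y hu) humin hu hv
  have h2 := inner_nonneg_of_isMinOn Q.convex_box (h.hasGradientAt Γ p z' y hv) hvmin hv hu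
  have h3 := h.inner_proxGradient_sub_ge p hΓ z y hu hv
  have e1 : Q.proxGradient Γ p v z' y = Q.proxGradient Γ p v z y - p • (z' - z) := by
    simp only [proxGradient]
    module
  have e2 : v - u = -(u - v) := by abel
  rw [e1, inner_sub_left, real_inner_smul_left] at h2
  rw [e2, inner_neg_right] at h1
  rw [inner_sub_left] at h3
  have h4 := mul_le_mul_of_nonneg_left (abs_real_inner_le_norm (z' - z) (u - v)) hp
  have h5 := mul_le_mul_of_nonneg_left (neg_abs_le (inner ℝ (z' - z) (u - v))) hp
  rw [div_mul_eq_mul_div, le_div_iff₀ hκ]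
  rcases (norm_nonneg (u - v)).eq_or_lt with h0 | h0
  · rw [← h0, zero_mul]
    positivity
  · refine le_of_mul_le_mul_right ?_ h0
    nlinarith

/-- The dual error bound: if `u` minimizes `K(·, z; y)` over the box and `s` minimizes it over the
feasible set, then `‖s - u‖` is at most a constant, independent of `y` and `z`, times the residual
of `u`. With `d` a conformal solution of `A d = A (s - u)`, the points `u + d` and `s - d` lie in
the box, `u + d` has the residual of `s`, and `s - d` that of `u`. The optimality
conditions of `s` and of `u` can be tested with these points, and the multiplier `y` drops out. -/
lemma exists_dual_error_bound (h : Q.SmoothOnBox L γ) {Γ p : ℝ} (hΓ : 0 ≤ Γ) (hp : 0 ≤ p)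
    (hL : 0 ≤ L) (hκ : 0 < p + γ) : ∃ C : ℝ, 0 ≤ C ∧ ∀ (z : EuclideanSpace ℝ (Fin n))
      (y : EuclideanSpace ℝ (Fin m)), ∀ u ∈ Q.box, ∀ s ∈ Q.feasibleSet,
      IsMinOn (fun x => Q.proxLagrangian Γ p x z y) Q.box u →
      IsMinOn (fun x => Q.proxLagrangian Γ p x z 0) Q.feasibleSet s →
      ‖s - u‖ ≤ C * ‖Q.residual u‖ := by
  obtain ⟨C, hC, hconf⟩ := exists_conformal Q.A.toEuclideanLin
  have hLK : 0 ≤ L + p + Γ * Q.sigma ^ 2 := by positivity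
  refine ⟨(L + p + Γ * Q.sigma ^ 2) * C / (p + γ), by positivity,
    fun z y u hu s hs humin hsmin => ?_⟩
  obtain ⟨d, hAd, hdconf, hdnorm⟩ := hconf (s - u)
  have hAsu : Q.A.toEuclideanLin (s - u) = -Q.residual u := by
    rw [← residual_sub_residual, hs.2, zero_sub]
  have hbounds : ∀ i, (0 ≤ d i ∧ d i ≤ s i - u i) ∨ (s i - u i ≤ d i ∧ d i ≤ 0) := fun i => by
    simpa [mem_uIcc] using hdconf i
  have hud : u + d ∈ Q.feasibleSet := by
    refine ⟨fun i => ?_, ?_⟩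
    · have := hu i
      have := hs.1 i
      rcases hbounds i with hi | hi <;> constructor <;> simp only [PiLp.add_apply] <;> linarith
    · have := residual_sub_residual Q (u + d) u
      rw [add_sub_cancel_left, hAd, hAsu] at this
      simpa using sub_eq_iff_eq_add.1 this
  have hsd : s - d ∈ Q.box := by
    intro i
    have := hu i
    have := hs.1 i
    rcases hbounds i with hi | hi <;> constructor <;> simp only [PiLp.sub_apply] <;> linarith
  have h1 := inner_nonneg_of_isMinOn Q.convex_box (h.hasGradientAt Γ p z y hu) humin hu hsd
  have h2 := inner_nonneg_of_isMinOn Q.convex_feasibleSet (h.hasGradientAt Γ p z 0 hs.1) hsmin hs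
    hud
  have e1 : Q.proxGradient Γ p u z y = Q.proxGradient Γ p u z 0 + Q.Aᵀ.toEuclideanLin y := by
    simp only [proxGradient, map_zero]
    module
  have e2 : s - d - u = (s - u) - d := by abel
  have e3 : u + d - s = d - (s - u) := by abel
  rw [e1, e2, inner_add_left, inner_transpose, map_sub, hAd, sub_self, inner_zero_right, add_zero,
    inner_sub_right] at h1
  rw [e3, inner_sub_right] at h2
  have h3 := h.inner_proxGradient_sub_ge p hΓ z 0 hs.1 hu
  have h4 := h.norm_proxGradient_sub_le hΓ hp z 0 hs.1 hu
  have h5 := real_inner_le_norm (Q.proxGradient Γ p s z 0 - Q.proxGradient Γ p u z 0) d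
  rw [inner_sub_left] at h3 h5
  rw [hAsu, norm_neg] at hdnorm
  have h6 := mul_le_mul h4 hdnorm (norm_nonneg _) (by positivity)
  rw [div_mul_eq_mul_div, le_div_iff₀ hκ]
  rcases (norm_nonneg (s - u)).eq_or_lt with h0 | h0
  · rw [← h0, zero_mul]
    positivity
  · refine le_of_mul_le_mul_right ?_ h0
    nlinarith

end SmoothOnBox

/-! ### Decrease of the potential -/

lemma proxLagrangian_add_multiplier (Γ p : ℝ) (x z : EuclideanSpace ℝ (Fin n))
    (y η : EuclideanSpace ℝ (Fin m)) :
    Q.proxLagrangian Γ p x z (y + η) =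
      Q.proxLagrangian Γ p x z y + inner ℝ η (Q.residual x) := by
  simp only [proxLagrangian, augLagrangian, inner_add_left]
  ring

lemma proxLagrangian_sub_prox (Γ p : ℝ) (x z z' : EuclideanSpace ℝ (Fin n))
    (y : EuclideanSpace ℝ (Fin m)) :
    Q.proxLagrangian Γ p x z' y - Q.proxLagrangian Γ p x z y =
      p / 2 * inner ℝ (z' - z) (z' + z - (2 : ℝ) • x) := by
  have e1 : x - z' = (x - z) - (z' - z) := by abel
  have e2 : z' + z - (2 : ℝ) • x = (z' - z) - (2 : ℝ) • (x - z) := by module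
  simp only [proxLagrangian]
  rw [e2, e1, norm_sub_sq_real, inner_sub_right (z' - z) (z' - z), real_inner_smul_right,
    real_inner_self_eq_norm_sq, real_inner_comm (z' - z) (x - z)]
  ring

namespace SmoothOnBox

variable {L γ : ℝ}

/-- Sufficient decrease of `K(·, z; y)` along a projected gradient step with `c` below the
reciprocal of the Lipschitz constant of the gradient. -/
lemma proxLagrangian_proj_le (h : Q.SmoothOnBox L γ) (hbox : ∀ i, Q.lo i < Q.up i)
    {Γ p c : ℝ} (hΓ : 0 ≤ Γ) (hp : 0 ≤ p) (hc : 0 < c)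
    (hcL : c * (L + p + Γ * Q.sigma ^ 2) ≤ 1)
    {x z : EuclideanSpace ℝ (Fin n)} {y : EuclideanSpace ℝ (Fin m)} (hx : x ∈ Q.box) :
    Q.proxLagrangian Γ p (Q.proj (x - c • Q.proxGradient Γ p x z y)) z y ≤
      Q.proxLagrangian Γ p x z y -
        1 / (2 * c) * ‖x - Q.proj (x - c • Q.proxGradient Γ p x z y)‖ ^ 2 := by
  set G := Q.proxGradient Γ p x z y with hG
  set x' := Q.proj (x - c • G) with hx'
  have h1 := inner_sub_proj_nonpos (x - c • G) hx
  have h2 := le_add_inner_add_of_lipschitz Q.convex_box (fun x hx => h.hasGradientAt Γ p z y hx)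
    (fun x hx x' hx' => h.norm_proxGradient_sub_le hΓ hp z y hx hx') hx
    (proj_mem hbox (x - c • G))
  rw [← hx'] at h1 h2
  rw [← hG, norm_sub_rev x' x] at h2
  have e1 : x - c • G - x' = (x - x') - c • G := by abel
  have e2 : x' - x = -(x - x') := by abel
  rw [e1, inner_sub_left, real_inner_smul_left, real_inner_self_eq_norm_sq] at h1
  rw [e2, inner_neg_right] at h2
  have h3 : ‖x - x'‖ ^ 2 / c ≤ inner ℝ G (x - x') := by
    rw [div_le_iff₀ hc]
    linarith
  have h4 : (L + p + Γ * Q.sigma ^ 2) / 2 * ‖x - x'‖ ^ 2 ≤ 1 / (2 * c) * ‖x - x'‖ ^ 2 := by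
    refine mul_le_mul_of_nonneg_right ?_ (sq_nonneg _)
    rw [div_le_div_iff₀ two_pos (by positivity)]
    linarith
  have e3 : ‖x - x'‖ ^ 2 / c = 2 * (1 / (2 * c) * ‖x - x'‖ ^ 2) := by
    field_simp
  linarith

/-- One iteration decreases the potential `K(x, z; y) - 2 d(y, z) + 2 M(z)`, where `d(y, z)` is the
minimum of `K(·, z; y)` over the box, attained at `u₀` before and at `v` after the iteration, and
`M(z)` is its minimum over the feasible set, attained at `s` and `s'`. The two cross terms are
absorbed: `‖A(x - u)‖` by the step in `x`, through the primal error bound and the smallness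
of `α`, and `⟪z' - z, s - v⟫` by the step in `z` and the residual of `u`, through the dual error
bound and the smallness of `β`. -/
lemma potential_decrease (h : Q.SmoothOnBox L γ) (hbox : ∀ i, Q.lo i < Q.up i)
    {Γ p c α β C₁ C₂ : ℝ} (hΓ : 0 ≤ Γ) (hp : 0 < p) (hκ : 0 < p + γ) (hc : 0 < c)
    (hcL : c * (L + p + Γ * Q.sigma ^ 2) ≤ 1) (hα : 0 < α) (hβ : 0 < β) (hβ1 : β ≤ 1)
    (hC₁ : C₁ = (1 + c * (L + p + Γ * Q.sigma ^ 2)) / (c * (p + γ)))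
    (hαC : α * (Q.sigma * C₁) ^ 2 ≤ 1 / (4 * c))
    (hβC : 2 * p ^ 2 * C₂ ^ 2 / α + 2 * p ^ 2 / (p + γ) ≤ p / (4 * β))
    {x z x' z' u u₀ v s s' : EuclideanSpace ℝ (Fin n)} {y y' : EuclideanSpace ℝ (Fin m)}
    (hx : x ∈ Q.box) (hy' : y' = y + α • Q.residual x)
    (hx' : x' = Q.proj (x - c • Q.proxGradient Γ p x z y')) (hz' : z' = z + β • (x' - z))
    (hu : u ∈ Q.box) (humin : IsMinOn (fun x => Q.proxLagrangian Γ p x z y') Q.box u)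
    (hu₀min : IsMinOn (fun x => Q.proxLagrangian Γ p x z y) Q.box u₀)
    (hv : v ∈ Q.box) (hvmin : IsMinOn (fun x => Q.proxLagrangian Γ p x z' y') Q.box v)
    (hs : s ∈ Q.feasibleSet)
    (hs'min : IsMinOn (fun x => Q.proxLagrangian Γ p x z' 0) Q.feasibleSet s')
    (hdual : ‖s - u‖ ≤ C₂ * ‖Q.residual u‖) :
    1 / (4 * c) * ‖x - x'‖ ^ 2 + α / 2 * ‖Q.residual u‖ ^ 2 + p / (4 * β) * ‖z' - z‖ ^ 2 ≤
      (Q.proxLagrangian Γ p x z y - 2 * Q.proxLagrangian Γ p u₀ z y +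
        2 * Q.proxLagrangian Γ p s z 0) -
      (Q.proxLagrangian Γ p x' z' y' - 2 * Q.proxLagrangian Γ p v z' y' +
        2 * Q.proxLagrangian Γ p s' z' 0) := by
  -- Decrease of `K`: the multiplier step costs `α` times the squared residual of `x`,
  -- and the other two steps gain.
  have hK1 : Q.proxLagrangian Γ p x z y' =
      Q.proxLagrangian Γ p x z y + α * ‖Q.residual x‖ ^ 2 := by
    rw [hy', proxLagrangian_add_multiplier, real_inner_smul_left, real_inner_self_eq_norm_sq]
  have hK2 := h.proxLagrangian_proj_le (z := z) (y := y') hbox hΓ hp.le hc hcL hx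
  rw [← hx'] at hK2
  have hK3 : Q.proxLagrangian Γ p x' z' y' - Q.proxLagrangian Γ p x' z y' ≤
      -(p / (2 * β) * ‖z' - z‖ ^ 2) := by
    have e : z' + z - (2 : ℝ) • x' = (1 - 2 * β⁻¹) • (z' - z) := by
      have : x' - z = β⁻¹ • (z' - z) := by
        rw [hz', add_sub_cancel_left, smul_smul, inv_mul_cancel₀ hβ.ne', one_smul]
      have e1 : z' + z - (2 : ℝ) • x' = (z' - z) - (2 : ℝ) • (x' - z) := by module
      rw [e1, this]
      module
    rw [proxLagrangian_sub_prox, e, real_inner_smul_right, real_inner_self_eq_norm_sq]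
    have h1 : 1 ≤ β⁻¹ := (one_le_inv₀ hβ).2 hβ1
    have e2 : p / (2 * β) = p / 2 * β⁻¹ := by field_simp
    rw [e2]
    nlinarith [mul_nonneg hp.le (sq_nonneg ‖z' - z‖)]
  -- Increase of `d`, from the optimality of `u₀` and `u` and the values of `K` at `u` and `v`.
  have hD1 : Q.proxLagrangian Γ p u₀ z y + α * inner ℝ (Q.residual x) (Q.residual u) ≤
      Q.proxLagrangian Γ p u z y' := by
    rw [hy', proxLagrangian_add_multiplier, real_inner_smul_left]
    exact add_le_add_left (hu₀min hu) _
  have hD2 : Q.proxLagrangian Γ p u z y' ≤ Q.proxLagrangian Γ p v z y' := humin hv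
  have hD3 := proxLagrangian_sub_prox (Q := Q) Γ p v z z' y'
  -- Increase of `M`, from the optimality of `s'`.
  have hM1 : Q.proxLagrangian Γ p s' z' 0 ≤ Q.proxLagrangian Γ p s z' 0 := hs'min hs
  have hM2 := proxLagrangian_sub_prox (Q := Q) Γ p s z z' 0
  -- Writing `r` for the residual, `-α ‖r x‖² + 2 α ⟪r x, r u⟫ = α ‖r u‖² - α ‖r x - r u‖²`.
  have hR := norm_sub_sq_real (Q.residual x) (Q.residual u)
  have hprim := h.norm_sub_minimizer_le hbox hΓ hp.le hκ hc hx hu humin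
  rw [← hx', ← hC₁] at hprim
  have hR2 : α * ‖Q.residual x - Q.residual u‖ ^ 2 ≤ 1 / (4 * c) * ‖x - x'‖ ^ 2 := by
    have h1 : ‖Q.residual x - Q.residual u‖ ≤ Q.sigma * C₁ * ‖x - x'‖ := by
      rw [mul_assoc]
      exact (Q.norm_residual_sub_le x u).trans
        (mul_le_mul_of_nonneg_left hprim Q.sigma_nonneg)
    calc α * ‖Q.residual x - Q.residual u‖ ^ 2 ≤ α * (Q.sigma * C₁ * ‖x - x'‖) ^ 2 := by gcongr
      _ = α * (Q.sigma * C₁) ^ 2 * ‖x - x'‖ ^ 2 := by ring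
      _ ≤ _ := mul_le_mul_of_nonneg_right hαC (sq_nonneg _)
  -- The error bounds estimate `s - v` through `s - v = (s - u) + (u - v)`.
  have hZ : -(2 * p * inner ℝ (z' - z) (s - v)) ≤
      α / 2 * ‖Q.residual u‖ ^ 2 + p / (4 * β) * ‖z' - z‖ ^ 2 := by
    have h1 := h.norm_minimizer_sub_le hΓ hp.le hκ hu hv humin hvmin
    have h2 : ‖s - v‖ ≤ C₂ * ‖Q.residual u‖ + p / (p + γ) * ‖z' - z‖ := by
      rw [← sub_add_sub_cancel s u v]
      exact (norm_add_le _ _).trans (add_le_add hdual h1)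
    have h3 := (neg_le_abs _).trans (abs_real_inner_le_norm (z' - z) (s - v))
    have h4 := mul_le_mul_of_nonneg_left h2 (norm_nonneg (z' - z))
    have h5 := mul_le_mul_of_nonneg_right hβC (sq_nonneg ‖z' - z‖)
    -- Young's inequality with weights `α / 2` and `2 p² C₂² / α`.
    have h6 : 2 * p * (‖z' - z‖ * (C₂ * ‖Q.residual u‖)) ≤
        α / 2 * ‖Q.residual u‖ ^ 2 + 2 * p ^ 2 * C₂ ^ 2 / α * ‖z' - z‖ ^ 2 := by
      have e : α / 2 * ‖Q.residual u‖ ^ 2 + 2 * p ^ 2 * C₂ ^ 2 / α * ‖z' - z‖ ^ 2 -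
          2 * p * (‖z' - z‖ * (C₂ * ‖Q.residual u‖)) =
          α / 2 * (‖Q.residual u‖ - 2 * p * C₂ / α * ‖z' - z‖) ^ 2 := by
        field_simp
        ring
      have : 0 ≤ α / 2 * (‖Q.residual u‖ - 2 * p * C₂ / α * ‖z' - z‖) ^ 2 := by positivity
      linarith
    have h7 : 2 * p * (‖z' - z‖ * (p / (p + γ) * ‖z' - z‖)) =
        2 * p ^ 2 / (p + γ) * ‖z' - z‖ ^ 2 := by ring
    have h8 : -(2 * p * inner ℝ (z' - z) (s - v)) ≤
        2 * p * (‖z' - z‖ * (C₂ * ‖Q.residual u‖ + p / (p + γ) * ‖z' - z‖)) := by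
      have := mul_le_mul_of_nonneg_left (h3.trans h4) (by positivity : 0 ≤ 2 * p)
      linarith
    rw [mul_add, mul_add] at h8
    rw [add_mul] at h5
    linarith
  have hZ2 : p * inner ℝ (z' - z) (z' + z - (2 : ℝ) • v) -
      p * inner ℝ (z' - z) (z' + z - (2 : ℝ) • s) = 2 * p * inner ℝ (z' - z) (s - v) := by
    simp only [inner_sub_right, real_inner_smul_right]
    ring
  have e1 : 1 / (2 * c) * ‖x - x'‖ ^ 2 = 2 * (1 / (4 * c) * ‖x - x'‖ ^ 2) := by ring
  have e2 : p / (2 * β) * ‖z' - z‖ ^ 2 = 2 * (p / (4 * β) * ‖z' - z‖ ^ 2) := by ring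
  have hR' : α * ‖Q.residual x - Q.residual u‖ ^ 2 = α * ‖Q.residual x‖ ^ 2 -
      2 * (α * inner ℝ (Q.residual x) (Q.residual u)) + α * ‖Q.residual u‖ ^ 2 := by
    rw [hR]
    ring
  linarith

/-- The three quantities that the potential controls bound the violation of the optimality
conditions. The element of the normal cone of the box at `x'` is the defect of the projection,
`(x - x') / c - ∇ₓK(x, z; y)`. -/
lemma isEpsSolution_proj (h : Q.SmoothOnBox L γ) (hbox : ∀ i, Q.lo i < Q.up i)
    {Γ p c β C₁ : ℝ} (hΓ : 0 ≤ Γ) (hp : 0 < p) (hκ : 0 < p + γ) (hc : 0 < c) (hβ : 0 < β)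
    (hC₁ : C₁ = (1 + c * (L + p + Γ * Q.sigma ^ 2)) / (c * (p + γ)))
    (hL : 0 ≤ L) {x z x' z' u : EuclideanSpace ℝ (Fin n)} {y : EuclideanSpace ℝ (Fin m)}
    (hx : x ∈ Q.box) (hx' : x' = Q.proj (x - c • Q.proxGradient Γ p x z y))
    (hz' : z' = z + β • (x' - z))
    (hu : u ∈ Q.box) (humin : IsMinOn (fun x => Q.proxLagrangian Γ p x z y) Q.box u) :
    Q.IsEpsSolution
      ((Q.sigma * (C₁ + 1) + L + Γ * Q.sigma ^ 2 * C₁ + p + 1 / c) * ‖x - x'‖ +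
        (1 + Γ * Q.sigma) * ‖Q.residual u‖ + p / β * ‖z' - z‖) x' y := by
  have hσ := Q.sigma_nonneg
  have hC₁0 : 0 ≤ C₁ := by rw [hC₁]; positivity
  have hx'mem : x' ∈ Q.box := hx' ▸ proj_mem hbox _
  have hprim := h.norm_sub_minimizer_le hbox hΓ hp.le hκ hc hx hu humin
  rw [← hx', ← hC₁] at hprim
  have hrx : ‖Q.residual x‖ ≤ ‖Q.residual u‖ + Q.sigma * (C₁ * ‖x - x'‖) := by
    have h1 := norm_add_le (Q.residual x - Q.residual u) (Q.residual u)
    rw [sub_add_cancel] at h1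
    have h2 := (Q.norm_residual_sub_le x u).trans (mul_le_mul_of_nonneg_left hprim hσ)
    linarith
  have ha := norm_nonneg (x - x')
  have hr := norm_nonneg (Q.residual u)
  have hq := norm_nonneg (z' - z)
  constructor
  · change ‖Q.residual x'‖ ≤ _
    have h1 := norm_sub_le (Q.residual x) (Q.residual x - Q.residual x')
    rw [sub_sub_cancel] at h1
    have h2 := Q.norm_residual_sub_le x x'
    have h3 : 0 ≤ (L + Γ * Q.sigma ^ 2 * C₁ + p + 1 / c) * ‖x - x'‖ +
        Γ * Q.sigma * ‖Q.residual u‖ + p / β * ‖z' - z‖ := by positivity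
    linarith
  · refine ⟨(1 / c) • (x - x') - Q.proxGradient Γ p x z y,
      mem_subdifferential_convexIndicator hx'mem fun w hw => ?_, ?_⟩
    · have h1 := inner_sub_proj_nonpos (x - c • Q.proxGradient Γ p x z y) hw
      rw [← hx'] at h1
      have e : (1 / c) • (x - x') - Q.proxGradient Γ p x z y =
          (1 / c) • (x - c • Q.proxGradient Γ p x z y - x') := by
        rw [sub_right_comm, smul_sub (1 / c) (x - x'), smul_smul, one_div_mul_cancel hc.ne',
          one_smul]
      rw [e, real_inner_smul_left]
      exact mul_nonpos_of_nonneg_of_nonpos (by positivity) h1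
    · have e : ∇ Q.f x' + Q.Aᵀ.toEuclideanLin y +
          ((1 / c) • (x - x') - Q.proxGradient Γ p x z y) =
          (1 / c) • (x - x') - (∇ Q.f x - ∇ Q.f x') -
            Γ • Q.Aᵀ.toEuclideanLin (Q.residual x) - p • (x - z) := by
        simp only [proxGradient]
        abel
      have h1 := h.lipschitz x hx x' hx'mem
      have h2 := mul_le_mul_of_nonneg_left ((Q.norm_transpose_mulVec_le (Q.residual x)).trans
        (mul_le_mul_of_nonneg_left hrx hσ)) hΓ
      have h3 : ‖x - z‖ ≤ ‖x - x'‖ + β⁻¹ * ‖z' - z‖ := by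
        have : x' - z = β⁻¹ • (z' - z) := by
          rw [hz', add_sub_cancel_left, smul_smul, inv_mul_cancel₀ hβ.ne', one_smul]
        rw [← sub_add_sub_cancel x x' z, this]
        refine (norm_add_le _ _).trans ?_
        rw [norm_smul, Real.norm_of_nonneg (inv_nonneg.2 hβ.le)]
      have h4 := mul_le_mul_of_nonneg_left h3 hp.le
      rw [e]
      refine (norm_sub_le_of_le (norm_sub_le_of_le (norm_sub_le_of_le le_rfl le_rfl) le_rfl)
        le_rfl).trans ?_
      rw [norm_smul, norm_smul, norm_smul, Real.norm_of_nonneg hΓ, Real.norm_of_nonneg hp.le,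
        Real.norm_of_nonneg (by positivity : 0 ≤ 1 / c)]
      have h5 : 0 ≤ Q.sigma * (C₁ + 1) * ‖x - x'‖ := by positivity
      have e2 : p / β * ‖z' - z‖ = p * (β⁻¹ * ‖z' - z‖) := by ring
      rw [e2]
      linarith

end SmoothOnBox

/-! ### The rate of convergence -/

/-- A sequence bounded below by `V₀` has, among its first `t` decrements, one that is at most the
average `(V 0 - V₀) / t`. -/
lemma exists_le_div_of_decrease {V D : ℕ → ℝ} {V₀ : ℝ} (hV : ∀ k, V₀ ≤ V k)
    (hD : ∀ k, D k ≤ V k - V (k + 1)) {t : ℕ} (ht : 0 < t) :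
    ∃ k < t, D k ≤ (V 0 - V₀) / t := by
  have hsum : ∑ k ∈ Finset.range t, D k ≤ ∑ _k ∈ Finset.range t, (V 0 - V₀) / t := by
    calc ∑ k ∈ Finset.range t, D k ≤ ∑ k ∈ Finset.range t, (V k - V (k + 1)) :=
          Finset.sum_le_sum fun k _ => hD k
      _ = V 0 - V t := Finset.sum_range_sub' V t
      _ ≤ V 0 - V₀ := by linarith [hV t]
      _ = ∑ _k ∈ Finset.range t, (V 0 - V₀) / t := by
          rw [Finset.sum_const, Finset.card_range, nsmul_eq_mul]
          field_simp
  obtain ⟨k, hk, hle⟩ := Finset.exists_le_of_sum_le ⟨0, Finset.mem_range.2 ht⟩ hsum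
  exact ⟨k, Finset.mem_range.1 hk, hle⟩

/-- A bound `B₀ / √t` on the best of the first `t` iterates yields both conclusions with
`B = 2 B₀`: the slack makes up for rounding `B² / ε²` down to an integer. -/
lemma complexity_of_rate {P : ℝ → ℕ → Prop} (hmono : ∀ {ε ε' : ℝ} {k : ℕ}, ε ≤ ε' → P ε k → P ε' k)
    {B₀ : ℝ} (hB₀ : 0 < B₀) (hrate : ∀ t : ℕ, 0 < t → ∃ k < t, P (B₀ / √(t : ℝ)) k) :
    (∀ t : ℕ, 0 < t → ∃ k < t, P (2 * B₀ / √(t : ℝ)) k) ∧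
      ∀ ε : ℝ, 0 < ε → ∃ k : ℕ, ((k + 1 : ℕ) : ℝ) ≤ max 1 ((2 * B₀) ^ 2 / ε ^ 2) ∧ P ε k := by
  constructor
  · intro t ht
    obtain ⟨k, hk, hP⟩ := hrate t ht
    exact ⟨k, hk, hmono (by gcongr; linarith) hP⟩
  · intro ε hε
    set N := (2 * B₀) ^ 2 / ε ^ 2 with hN
    have hN0 : 0 ≤ N := by positivity
    -- The number of iterations is `N` rounded down, but at least one.
    have ht : 0 < max 1 ⌊N⌋₊ := by simp
    obtain ⟨k, hk, hP⟩ := hrate _ ht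
    refine ⟨k, ?_, hmono ?_ hP⟩
    · calc ((k + 1 : ℕ) : ℝ) ≤ ((max 1 ⌊N⌋₊ : ℕ) : ℝ) := by exact_mod_cast hk
        _ = max 1 (⌊N⌋₊ : ℝ) := by push_cast; rfl
        _ ≤ max 1 N := max_le_max le_rfl (Nat.floor_le hN0)
    · have h1 : N < 2 * ((max 1 ⌊N⌋₊ : ℕ) : ℝ) := by
        have h2 := Nat.lt_floor_add_one N
        have h3 : ((1 : ℕ) : ℝ) ≤ ((max 1 ⌊N⌋₊ : ℕ) : ℝ) := by exact_mod_cast le_max_left _ _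
        have h4 : (⌊N⌋₊ : ℝ) ≤ ((max 1 ⌊N⌋₊ : ℕ) : ℝ) := by exact_mod_cast le_max_right _ _
        push_cast at h3 h4 ⊢
        linarith
      have htpos : (0 : ℝ) < ((max 1 ⌊N⌋₊ : ℕ) : ℝ) := by exact_mod_cast ht
      rw [div_le_iff₀ (Real.sqrt_pos.2 htpos)]
      refine le_of_sq_le_sq ?_ (by positivity)
      rw [mul_pow, Real.sq_sqrt htpos.le]
      rw [hN, div_lt_iff₀ (by positivity)] at h1
      nlinarith [sq_nonneg B₀, sq_nonneg ε]

end Problem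

end ProxALM

end

theorem mainTheorem2 {n m : ℕ} (Q : ProxALM.Problem n m)
    (hbox : ∀ i, Q.lo i < Q.up i)
    -- the origin lies in the relative interior of `AP - b`
    (hint : (0 : EuclideanSpace ℝ (Fin m)) ∈ intrinsicInterior ℝ (Q.residual '' Q.box))
    (hsc : Q.StrictComplementarity)
    (hdiff : ∀ x ∈ Q.box, DifferentiableAt ℝ Q.f x)
    (L : ℝ) (hL : 0 < L)
    (hlip : ∀ x ∈ Q.box, ∀ x' ∈ Q.box, ‖∇ Q.f x - ∇ Q.f x'‖ ≤ L * ‖x - x'‖)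
    (γ : ℝ)
    (hγ : ∀ x ∈ Q.box, ∀ x' ∈ Q.box,
      γ * ‖x - x'‖ ^ 2 ≤ inner ℝ (∇ Q.f x - ∇ Q.f x') (x - x'))
    (Γ p c : ℝ) (hΓ : 0 < Γ) (hp : 0 < p) (hpγ : -γ < p)
    (hc : 0 < c) (hcL : c < 1 / (L + p + Γ * Q.sigma ^ 2)) :
    -- sufficiently small dual stepsize `α` and then sufficiently small primal stepsize `β`
    ∃ α₀ : ℝ, 0 < α₀ ∧ ∀ α : ℝ, 0 < α → α < α₀ →
    ∃ β₀ : ℝ, 0 < β₀ ∧ ∀ β : ℝ, 0 < β → β ≤ 1 → β < β₀ →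
    ∀ x₀ ∈ Q.box, ∀ z₀ ∈ Q.box, ∀ y₀ : EuclideanSpace ℝ (Fin m),
    ∃ B : ℝ, 0 < B ∧
      (∀ t : ℕ, 0 < t → ∃ s : ℕ, s < t ∧
        Q.IsEpsSolution (B / √(t : ℝ))
          (Q.iterate Γ p c α β ⟨x₀, y₀, z₀⟩ (s + 1)).x
          (Q.iterate Γ p c α β ⟨x₀, y₀, z₀⟩ (s + 1)).y) ∧
      (∀ ε : ℝ, 0 < ε → ∃ s : ℕ, ((s + 1 : ℕ) : ℝ) ≤ max 1 (B ^ 2 / ε ^ 2) ∧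
        Q.IsEpsSolution ε
          (Q.iterate Γ p c α β ⟨x₀, y₀, z₀⟩ (s + 1)).x
          (Q.iterate Γ p c α β ⟨x₀, y₀, z₀⟩ (s + 1)).y) := by
  have h : Q.SmoothOnBox L γ := ⟨hdiff, hlip, hγ⟩
  have hκ : 0 < p + γ := by linarith
  have hLK : 0 < L + p + Γ * Q.sigma ^ 2 := by positivity
  have hcLK : c * (L + p + Γ * Q.sigma ^ 2) ≤ 1 := ((lt_div_iff₀ hLK).1 hcL).le
  obtain ⟨xf, hxf, hxf0⟩ := intrinsicInterior_subset hint
  obtain ⟨C₂, -, hdual⟩ := h.exists_dual_error_bound hΓ.le hp.le hL.le hκ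
  choose U hU hUmin using fun y z => h.exists_isMinOn_box ⟨xf, hxf⟩ Γ p z y
  choose S hS hSmin using fun z => h.exists_isMinOn_feasibleSet ⟨xf, hxf, hxf0⟩ Γ p z 0
  obtain ⟨xm, -, hxm⟩ := Q.isCompact_box.exists_isMinOn ⟨xf, hxf⟩
    fun x hx => (hdiff x hx).continuousAt.continuousWithinAt
  obtain ⟨C₁, hC₁⟩ : ∃ C₁, C₁ = (1 + c * (L + p + Γ * Q.sigma ^ 2)) / (c * (p + γ)) := ⟨_, rfl⟩
  have hC₁0 : 0 ≤ C₁ := by rw [hC₁]; positivity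
  have hσ := Q.sigma_nonneg
  -- `α₀` and `β₀` are the thresholds below which the cross terms of the potential are absorbed.
  refine ⟨1 / (4 * c * ((Q.sigma * C₁) ^ 2 + 1)), by positivity, fun α hα hαlt => ?_⟩
  have hαC : α * (Q.sigma * C₁) ^ 2 ≤ 1 / (4 * c) := by
    rw [lt_div_iff₀ (by positivity)] at hαlt
    rw [le_div_iff₀ (by positivity)]
    nlinarith [mul_pos hα hc]
  have hM : 0 < 2 * p ^ 2 * C₂ ^ 2 / α + 2 * p ^ 2 / (p + γ) := by positivity
  refine ⟨p / (4 * (2 * p ^ 2 * C₂ ^ 2 / α + 2 * p ^ 2 / (p + γ))), by positivity,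
    fun β hβ hβ1 hβlt x₀ hx₀ z₀ _ y₀ => ?_⟩
  have hβC : 2 * p ^ 2 * C₂ ^ 2 / α + 2 * p ^ 2 / (p + γ) ≤ p / (4 * β) := by
    rw [lt_div_iff₀ (by positivity)] at hβlt
    rw [le_div_iff₀ (by positivity)]
    linarith
  set w := Q.iterate Γ p c α β ⟨x₀, y₀, z₀⟩ with hw
  have hwx : ∀ k, (w k).x ∈ Q.box
    | 0 => hx₀
    | k + 1 => ProxALM.Problem.proj_mem hbox _
  have hy : ∀ k, (w (k + 1)).y = (w k).y + α • Q.residual (w k).x := fun k => rfl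
  have hx : ∀ k, (w (k + 1)).x =
      Q.proj ((w k).x - c • Q.proxGradient Γ p (w k).x (w k).z (w (k + 1)).y) := fun k => by
    rw [← (h.hasGradientAt Γ p (w k).z (w (k + 1)).y (hwx k)).gradient]
    rfl
  have hz : ∀ k, (w (k + 1)).z = (w k).z + β • ((w (k + 1)).x - (w k).z) := fun k => rfl
  let V : ℕ → ℝ := fun k => Q.proxLagrangian Γ p (w k).x (w k).z (w k).y -
    2 * Q.proxLagrangian Γ p (U (w k).y (w k).z) (w k).z (w k).y +
    2 * Q.proxLagrangian Γ p (S (w k).z) (w k).z 0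
  let a : ℕ → ℝ := fun k => ‖(w k).x - (w (k + 1)).x‖
  let r : ℕ → ℝ := fun k => ‖Q.residual (U (w (k + 1)).y (w k).z)‖
  let q : ℕ → ℝ := fun k => ‖(w (k + 1)).z - (w k).z‖
  let D : ℕ → ℝ := fun k => 1 / (4 * c) * a k ^ 2 + α / 2 * r k ^ 2 + p / (4 * β) * q k ^ 2
  have hD : ∀ k, D k ≤ V k - V (k + 1) := fun k =>
    h.potential_decrease hbox hΓ.le hp hκ hc hcLK hα hβ hβ1 hC₁ hαC hβC (hwx k) (hy k) (hx k)
      (hz k) (hU _ _) (hUmin _ _) (hUmin _ _) (hU _ _) (hUmin _ _) (hS _) (hSmin _)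
      (hdual _ _ _ (hU _ _) _ (hS _) (hUmin _ _) (hSmin _))
  -- `K - 2 d + 2 M = (K - d) + (M - d) + M` with `d ≤ K`, `d ≤ M` and `min f ≤ M`.
  have hV : ∀ k, Q.f xm ≤ V k := fun k => by
    have h1 : Q.proxLagrangian Γ p (U (w k).y (w k).z) (w k).z (w k).y ≤
      Q.proxLagrangian Γ p (w k).x (w k).z (w k).y := hUmin _ _ (hwx k)
    have h2 : Q.proxLagrangian Γ p (U (w k).y (w k).z) (w k).z (w k).y ≤
      Q.proxLagrangian Γ p (S (w k).z) (w k).z (w k).y := hUmin _ _ (hS _).1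
    have h3 : Q.f xm ≤ Q.f (S (w k).z) := hxm (hS _).1
    have h4 : 0 ≤ p / 2 * ‖S (w k).z - (w k).z‖ ^ 2 := by positivity
    rw [ProxALM.Problem.proxLagrangian_of_residual_eq_zero _ _ _ _ (hS _).2] at h2
    simp only [V, ProxALM.Problem.proxLagrangian_of_residual_eq_zero _ _ _ _ (hS _).2]
    linarith
  set k₁ := Q.sigma * (C₁ + 1) + L + Γ * Q.sigma ^ 2 * C₁ + p + 1 / c with hk₁
  set k₂ := 1 + Γ * Q.sigma with hk₂
  have hk₁0 : 0 ≤ k₁ := by positivity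
  have hk₂0 : 0 ≤ k₂ := by positivity
  have hsol : ∀ k, Q.IsEpsSolution (k₁ * a k + k₂ * r k + p / β * q k) (w (k + 1)).x
      (w (k + 1)).y := fun k =>
    h.isEpsSolution_proj hbox hΓ.le hp hκ hc hβ hC₁ hL.le (hwx k) (hx k) (hz k) (hU _ _)
      (hUmin _ _)
  -- Each summand of `D k ≤ δ` bounds one of the three quantities by a multiple of `√δ`.
  have hbound : ∀ k δ, 0 ≤ δ → D k ≤ δ → k₁ * a k + k₂ * r k + p / β * q k ≤
      (k₁ * √(4 * c) + k₂ * √(2 / α) + p / β * √(4 * β / p)) * √δ := by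
    intro k δ hδ hDk
    have h1 : 0 ≤ 1 / (4 * c) * a k ^ 2 := by positivity
    have h2 : 0 ≤ α / 2 * r k ^ 2 := by positivity
    have h3 : 0 ≤ p / (4 * β) * q k ^ 2 := by positivity
    have hsum : 1 / (4 * c) * a k ^ 2 + α / 2 * r k ^ 2 + p / (4 * β) * q k ^ 2 ≤ δ := hDk
    have ha : a k ≤ √(4 * c) * √δ := by
      rw [← Real.sqrt_mul (by positivity)]
      refine Real.le_sqrt_of_sq_le ?_
      calc a k ^ 2 = 4 * c * (1 / (4 * c) * a k ^ 2) := by field_simp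
        _ ≤ 4 * c * δ := by gcongr; linarith
    have hr : r k ≤ √(2 / α) * √δ := by
      rw [← Real.sqrt_mul (by positivity)]
      refine Real.le_sqrt_of_sq_le ?_
      calc r k ^ 2 = 2 / α * (α / 2 * r k ^ 2) := by field_simp
        _ ≤ 2 / α * δ := by gcongr; linarith
    have hq : q k ≤ √(4 * β / p) * √δ := by
      rw [← Real.sqrt_mul (by positivity)]
      refine Real.le_sqrt_of_sq_le ?_
      calc q k ^ 2 = 4 * β / p * (p / (4 * β) * q k ^ 2) := by field_simp
        _ ≤ 4 * β / p * δ := by gcongr; linarith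
    calc k₁ * a k + k₂ * r k + p / β * q k ≤ k₁ * (√(4 * c) * √δ) + k₂ * (√(2 / α) * √δ) +
          p / β * (√(4 * β / p) * √δ) := by gcongr
      _ = _ := by ring
  set C₃ := k₁ * √(4 * c) + k₂ * √(2 / α) + p / β * √(4 * β / p) with hC₃
  have hC₃0 : 0 ≤ C₃ := by positivity
  have hgap : 0 ≤ V 0 - Q.f xm := sub_nonneg.2 (hV 0)
  have hB₀ : 0 < C₃ * √(V 0 - Q.f xm) + 1 := by positivity
  have hrate : ∀ t : ℕ, 0 < t → ∃ k < t, Q.IsEpsSolution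
      ((C₃ * √(V 0 - Q.f xm) + 1) / √(t : ℝ)) (w (k + 1)).x (w (k + 1)).y := by
    intro t ht
    obtain ⟨k, hk, hDk⟩ := ProxALM.Problem.exists_le_div_of_decrease hV hD ht
    refine ⟨k, hk, (hsol k).mono ((hbound k _ (by positivity) hDk).trans ?_)⟩
    rw [Real.sqrt_div hgap, ← mul_div_assoc]
    gcongr
    linarith
  obtain ⟨h1, h2⟩ := ProxALM.Problem.complexity_of_rate
    (P := fun ε k => Q.IsEpsSolution ε (w (k + 1)).x (w (k + 1)).y)
    (fun hε hP => hP.mono hε) hB₀ hrate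
  exact ⟨_, by positivity, h1, h2⟩
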